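/- Consider a $K$-armed Gaussian bandit with abstention. An instance is a vector $\mu=(\mu_1,\dots,\mu_K)\in\mathbb R^K$ of arm means with a unique optimal arm, whose index is arbitrary and unknown to the agent; let $\mathcal U_K$ be the set of all such instances, let $i^*$ be the optimal arm of $\mu$, and let $\Delta_i:=\mu_{i^*}-\mu_i$. At each time step $t=1,2,\dots$ the agent chooses, possibly at random and depending on all previous choices and observations, an arm $A_t\in\{1,\dots,K\}$ and a bit $B_t\in\{0,1\}$ ($B_t=1$ means abstaining), and then, whether or not it abstained, observes $X_t\sim\mathcal N(\mu_{A_t},1)$, which given $A_t$ is independent of $B_t$ and of the past. Let $\Pi_K$ be the set of all such policies. In the fixed-regret setting with abstention regret $c>0$, the regret of a policy $\pi$ up to the horizon $T$ is $$R^{\mathrm{RG}}_{\mu,c}(T,\pi):=\mathbb E\Big[\sum_{t=1}^T\big((\mu_{i^*}-X_t)\mathbf 1\{B_t=0\}+c\,\mathbf 1\{B_t=1\}\big)\Big].$$ An algorithm may take $c$ and $T$ as inputs, that is, it chooses a policy in $\Pi_K$ for each pair $(c,T)$; its regret $R^{\mathrm{RG}}_{\mu,c}(T,\pi)$ is that of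 the policy chosen for $(c,T)$. An algorithm $\pi$ is called $R^{\mathrm{RG}}$-consistent if $R^{\mathrm{RG}}_{\mu,c}(T,\pi)=o(T^a)$ as $T\to\infty$ for all $c>0$, $\mu\in\mathcal U_K$ and $a>0$. Write $x\wedge y:=\min\{x,y\}$. (1) For every $K$, every abstention regret $c>0$, every instance $\mu\in\mathcal U_K$ and every $R^{\mathrm{RG}}$-consistent algorithm $\pi$, $$\liminf_{T\to\infty}\frac{R^{\mathrm{RG}}_{\mu,c}(T,\pi)}{\log T}\ \ge\ 2\sum_{i\ne i^*}\frac{\Delta_i\wedge c}{\Delta_i^2}.$$ (2) There is a universal constant $\alpha>0$ (not depending on $K$, $c$, $T$) such that for all $K\ge 2$, all $c>0$ and all horizons $T\ge K$, $$\inf_{\pi\in\Pi_K}\ \sup_{\mu\in\mathcal U_K} R^{\mathrm{RG}}_{\mu,c}(T,\pi)\ \ge\ \alpha\,\big(\sqrt{KT}\wedge cT\big).$$ -/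

import Mathlib

open MeasureTheory ProbabilityTheory Filter Asymptotics
open scoped ENNReal

namespace AbstentionBandit

/-- What happens in one time step of a `K`-armed bandit with abstention: `((A, B), X)`, where
`A` is the pulled arm, `B` is `true` if the agent abstains, and `X` is the observation. -/
abbrev Round (K : ℕ) : Type := (Fin K × Bool) × ℝ

/-- The interaction history `(A₁, B₁, X₁, …, Aₙ, Bₙ, Xₙ)` of the first `n` time steps. -/
abbrev History (K n : ℕ) : Type := Fin n → Round K

/-- An online (possibly randomized) policy: after `n` time steps, the next pair `(A, B)` is drawn
from a probability distribution that depends measurably on the history so far. -/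
structure Policy (K : ℕ) where
  /-- conditional law of the next arm and abstention decision, given the history -/
  act : (n : ℕ) → Kernel (History K n) (Fin K × Bool)
  markov : ∀ n, IsMarkovKernel (act n)

attribute [instance] Policy.markov

/-- The observation of arm `i` is drawn from the normal distribution `N (μ i, 1)`, whether or not
the agent abstains. -/
noncomputable def observe {K : ℕ} (μ : Fin K → ℝ) : Kernel (Fin K × Bool) ℝ :=
  Kernel.ofFunOfCountable fun ab => gaussianReal (μ ab.1) 1

instance {K : ℕ} (μ : Fin K → ℝ) : IsMarkovKernel (observe μ) :=
  ⟨fun ab => by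
    change IsProbabilityMeasure (gaussianReal (μ ab.1) 1)
    infer_instance⟩

/-- Conditional law of the next round, given the first `n` rounds. -/
noncomputable def Policy.step {K : ℕ} (π : Policy K) (μ : Fin K → ℝ) (n : ℕ) :
    Kernel (History K n) (Round K) :=
  π.act n ⊗ₖ Kernel.prodMkLeft (History K n) (observe μ)

instance {K : ℕ} (π : Policy K) (μ : Fin K → ℝ) (n : ℕ) : IsMarkovKernel (π.step μ n) := by
  unfold Policy.step
  infer_instance

/-- Law of the history of the first `n` rounds when policy `π` plays on the instance `μ`. -/
noncomputable def Policy.law {K : ℕ} (π : Policy K) (μ : Fin K → ℝ) :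
    (n : ℕ) → Measure (History K n)
  | 0 => Measure.dirac Fin.elim0
  | n + 1 => ((π.law μ n) ⊗ₘ (π.step μ n)).map
      fun p => (Fin.snoc p.1 p.2 : History K (n + 1))

theorem measurable_snoc (K n : ℕ) : Measurable
    fun p : History K n × Round K => (Fin.snoc p.1 p.2 : History K (n + 1)) := by
  refine measurable_pi_lambda _ fun i => ?_
  refine Fin.lastCases ?_ (fun j => ?_) i
  · simpa using measurable_snd
  · simp only [Fin.snoc_castSucc]
    exact (measurable_pi_apply j).comp measurable_fst

instance {K : ℕ} (π : Policy K) (μ : Fin K → ℝ) (n : ℕ) :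
    IsProbabilityMeasure (π.law μ n) := by
  induction n with
  | zero => unfold Policy.law; infer_instance
  | succ n ih =>
    unfold Policy.law
    exact Measure.isProbabilityMeasure_map (measurable_snoc K n).aemeasurable

/-- Expected cumulative regret up to horizon `T` in the fixed-regret setting: a step costs
`max μ - X` without abstention and `c` with abstention. -/
noncomputable def Policy.regretRG {K : ℕ} (π : Policy K) (μ : Fin K → ℝ) (c : ℝ) (T : ℕ) : ℝ :=
  ∫ h, ∑ t : Fin T, (if (h t).1.2 then c else (⨆ i, μ i) - (h t).2) ∂(π.law μ T)

/-- Arm `i` is the unique optimal arm of the instance `μ`. -/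
def IsUniqueOptimal {K : ℕ} (μ : Fin K → ℝ) (i : Fin K) : Prop :=
  ∀ j, j ≠ i → μ j < μ i

/-- The bandit instances: mean vectors with a unique optimal arm (which arm that is, is unknown
to the agent). -/
def instances (K : ℕ) : Set (Fin K → ℝ) := {μ | ∃ i, IsUniqueOptimal μ i}

/-- An algorithm for the fixed-regret setting may take the abstention regret `c` and the time
horizon `T` as inputs; then it plays a policy. -/
abbrev Algorithm (K : ℕ) : Type := ℝ → ℕ → Policy K

/-- The cumulative regret of an algorithm. -/
noncomputable def Algorithm.regretRG {K : ℕ} (π : Algorithm K) (μ : Fin K → ℝ) (c : ℝ) (T : ℕ) :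
    ℝ :=
  (π c T).regretRG μ c T

/-- Consistency: subpolynomial regret for all abstention regrets and all instances. -/
def Algorithm.IsRGConsistent {K : ℕ} (π : Algorithm K) : Prop :=
  ∀ c : ℝ, 0 < c → ∀ μ ∈ instances K, ∀ a : ℝ, 0 < a →
    (fun T : ℕ => Algorithm.regretRG π μ c T) =o[atTop] fun T : ℕ => (T : ℝ) ^ a

end AbstentionBandit

/-! Both bounds are two-point arguments. Abstaining does not change the law of the observation, so
information depends only on which arms are pulled, while a pull of arm `a` costs at least `min Δₐ c`
in conditional mean, whatever the abstention bit (`sum_mul_expPulls_le_regretRG`). Raise one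
suboptimal arm `i` to the value `μ j + d`, above the optimal arm `j`. The KL divergence between the
two history laws is then half the squared shift times the expected number of pulls of `i` under `μ`
(`integral_sumOver_logRatio`). By Bretagnolle–Huber, the two regrets add up to at least `min d c * T
/ 4 * exp (-KL)` (`two_point_bound_update`).

For (1), consistency bounds both regrets by `T ^ d`, which forces the divergence to be at least
about `log T`; letting `d → 0` gives about `2 / Δᵢ² * log T` pulls of each suboptimal arm, each
costing at least `min Δᵢ c`.

For (2), start from one arm of mean `d` and all others of mean `0`. Some arm `i ≠ 0` is pulled at
most `T / (K - 1)` times in expectation, so with `d` of order `√(K / T)` the divergence stays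
bounded and one of the two instances has large regret. -/

namespace AbstentionBandit

/-! ### Additive functionals of the history and the law of one round. -/

/-- The sum of a function of the rounds over a history. -/
noncomputable def sumOver {K n : ℕ} (g : Round K → ℝ) (h : History K n) : ℝ := ∑ t, g (h t)

theorem measurable_sumOver {K n : ℕ} {g : Round K → ℝ} (hg : Measurable g) :
    Measurable (sumOver g : History K n → ℝ) := by
  unfold sumOver
  fun_prop

theorem sumOver_snoc {K n : ℕ} (g : Round K → ℝ) (h : History K n) (r : Round K) :
    sumOver g (Fin.snoc h r : History K (n + 1)) = sumOver g h + g r := by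
  simp [sumOver, Fin.sum_univ_castSucc]

/-- Conditional mean of a function of the round, given the arm and the abstention decision. -/
noncomputable def condMean {K : ℕ} (μ : Fin K → ℝ) (g : Round K → ℝ) (ab : Fin K × Bool) : ℝ :=
  ∫ x, g (ab, x) ∂gaussianReal (μ ab.1) 1

/-- Marginal law of the arm and the abstention decision after `n` rounds. -/
noncomputable def Policy.choiceLaw {K : ℕ} (π : Policy K) (μ : Fin K → ℝ) (n : ℕ) :
    Measure (Fin K × Bool) :=
  (π.law μ n).bind (π.act n)

instance {K : ℕ} (π : Policy K) (μ : Fin K → ℝ) (n : ℕ) :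
    IsProbabilityMeasure (π.choiceLaw μ n) := by
  unfold Policy.choiceLaw
  infer_instance

/-- The observation depends on the past only through the chosen pair. Averaging out the history thus
leaves a measure on the finite type `Fin K × Bool` followed by `observe`, where integrability need
only be checked pair by pair. -/
theorem map_snd_law_compProd_step {K : ℕ} (π : Policy K) (μ : Fin K → ℝ) (n : ℕ) :
    ((π.law μ n) ⊗ₘ (π.step μ n)).map Prod.snd = (π.choiceLaw μ n) ⊗ₘ (observe μ) := by
  ext s hs
  rw [Measure.map_apply measurable_snd hs, Measure.compProd_apply (measurable_snd hs),
    Measure.compProd_apply hs, Policy.choiceLaw, Measure.lintegral_bind]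
  · refine lintegral_congr fun h => ?_
    rw [Policy.step]
    have : (Prod.mk h ⁻¹' (Prod.snd ⁻¹' s : Set (History K n × Round K))) = s := rfl
    rw [this, Kernel.compProd_apply hs]
    rfl
  · exact (π.act n).measurable.aemeasurable
  · exact (Kernel.measurable_kernel_prodMk_left hs).aemeasurable

/-! ### Expectations over histories, pull counts, and the regret in terms of pulls. -/

section Expectation

variable {K : ℕ} (π : Policy K) (μ : Fin K → ℝ)

theorem integrable_round {g : Round K → ℝ} (hg : Measurable g)
    (hi : ∀ ab, Integrable (fun x => g (ab, x)) (gaussianReal (μ ab.1) 1)) (n : ℕ) :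
    Integrable (fun p : History K n × Round K => g p.2) ((π.law μ n) ⊗ₘ (π.step μ n)) := by
  have : Integrable g (((π.law μ n) ⊗ₘ (π.step μ n)).map Prod.snd) := by
    rw [map_snd_law_compProd_step, Measure.integrable_compProd_iff hg.aestronglyMeasurable]
    exact ⟨ae_of_all _ hi, Integrable.of_finite⟩
  exact (integrable_map_measure hg.aestronglyMeasurable measurable_snd.aemeasurable).1 this

theorem integral_round {g : Round K → ℝ} (hg : Measurable g)
    (hi : ∀ ab, Integrable (fun x => g (ab, x)) (gaussianReal (μ ab.1) 1)) (n : ℕ) :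
    ∫ p, g p.2 ∂((π.law μ n) ⊗ₘ (π.step μ n)) = ∫ ab, condMean μ g ab ∂(π.choiceLaw μ n) := by
  have h1 : Integrable g (((π.law μ n) ⊗ₘ (π.step μ n)).map Prod.snd) :=
    (integrable_map_measure hg.aestronglyMeasurable measurable_snd.aemeasurable).2
      (integrable_round π μ hg hi n)
  rw [← integral_map (φ := Prod.snd) measurable_snd.aemeasurable hg.aestronglyMeasurable]
  rw [map_snd_law_compProd_step] at h1 ⊢
  rw [Measure.integral_compProd h1]
  rfl

theorem integrable_past {n : ℕ} {f : History K n → ℝ} (hf : Integrable f (π.law μ n)) :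
    Integrable (fun p : History K n × Round K => f p.1) ((π.law μ n) ⊗ₘ (π.step μ n)) := by
  have h : ((π.law μ n) ⊗ₘ (π.step μ n)).map Prod.fst = π.law μ n :=
    Measure.fst_compProd _ _
  rw [← h] at hf
  exact (integrable_map_measure hf.aestronglyMeasurable measurable_fst.aemeasurable).1 hf

theorem integral_past {n : ℕ} {f : History K n → ℝ} (hf : Integrable f (π.law μ n)) :
    ∫ p, f p.1 ∂((π.law μ n) ⊗ₘ (π.step μ n)) = ∫ h, f h ∂(π.law μ n) := by
  have h : ((π.law μ n) ⊗ₘ (π.step μ n)).map Prod.fst = π.law μ n :=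
    Measure.fst_compProd _ _
  have hf' := hf
  rw [← h] at hf'
  rw [← integral_map (φ := Prod.fst) measurable_fst.aemeasurable hf'.aestronglyMeasurable, h]

theorem integrable_sumOver {g : Round K → ℝ} (hg : Measurable g)
    (hi : ∀ ab, Integrable (fun x => g (ab, x)) (gaussianReal (μ ab.1) 1)) (n : ℕ) :
    Integrable (sumOver g) (π.law μ n) := by
  induction n with
  | zero => simp
  | succ n ih =>
    rw [Policy.law, integrable_map_measure (measurable_sumOver hg).aestronglyMeasurable
      (measurable_snoc K n).aemeasurable]
    simp only [Function.comp_def, sumOver_snoc]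
    exact (integrable_past π μ ih).add (integrable_round π μ hg hi n)

theorem integral_sumOver_succ {g : Round K → ℝ} (hg : Measurable g)
    (hi : ∀ ab, Integrable (fun x => g (ab, x)) (gaussianReal (μ ab.1) 1)) (n : ℕ) :
    ∫ h, sumOver g h ∂(π.law μ (n + 1)) =
      ∫ h, sumOver g h ∂(π.law μ n) + ∫ ab, condMean μ g ab ∂(π.choiceLaw μ n) := by
  have hn := integrable_sumOver π μ hg hi n
  rw [Policy.law, integral_map (measurable_snoc K n).aemeasurable
    (measurable_sumOver hg).aestronglyMeasurable]
  simp only [sumOver_snoc]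
  rw [integral_add (integrable_past π μ hn) (integrable_round π μ hg hi n),
    integral_past π μ hn, integral_round π μ hg hi n]

theorem integrable_sumOver_fst (f : Fin K × Bool → ℝ) (n : ℕ) :
    Integrable (sumOver fun r => f r.1) (π.law μ n) :=
  integrable_sumOver π μ (g := fun r => f r.1) ((measurable_of_finite f).comp measurable_fst)
    (fun ab => integrable_const (f ab)) n

/-- The expectation of a sum over rounds only depends on the conditional means of the summand. -/
theorem integral_sumOver {g : Round K → ℝ} (hg : Measurable g)
    (hi : ∀ ab, Integrable (fun x => g (ab, x)) (gaussianReal (μ ab.1) 1)) (n : ℕ) :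
    ∫ h, sumOver g h ∂(π.law μ n) = ∫ h, sumOver (fun r => condMean μ g r.1) h ∂(π.law μ n) := by
  induction n with
  | zero => simp [sumOver]
  | succ n ih =>
    rw [integral_sumOver_succ π μ hg hi, ih, integral_sumOver_succ π μ
      (g := fun r => condMean μ g r.1)
      ((measurable_of_finite (condMean μ g)).comp measurable_fst)
      (fun ab => integrable_const (condMean μ g ab))]
    congr 1
    exact integral_congr_ae (ae_of_all _ fun ab => by simp [condMean])

/-- Number of pulls of an arm in a history. -/
noncomputable def pulls {K n : ℕ} (a : Fin K) : History K n → ℝ :=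
  sumOver fun r => if r.1.1 = a then 1 else 0

theorem measurable_pulls {K n : ℕ} (a : Fin K) : Measurable (pulls a : History K n → ℝ) :=
  measurable_sumOver ((measurable_of_finite
    fun ab : Fin K × Bool => if ab.1 = a then (1 : ℝ) else 0).comp measurable_fst)

theorem pulls_nonneg {K n : ℕ} (a : Fin K) (h : History K n) : 0 ≤ pulls a h := by
  unfold pulls sumOver
  positivity

theorem sumOver_arm {K n : ℕ} (w : Fin K → ℝ) (h : History K n) :
    sumOver (fun r => w r.1.1) h = ∑ a, w a * pulls a h := by
  simp only [sumOver, pulls, Finset.mul_sum]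
  rw [Finset.sum_comm]
  simp

theorem sum_pulls {K n : ℕ} (h : History K n) : ∑ a, pulls a h = n := by
  have := sumOver_arm (fun _ => 1) h
  simp only [one_mul] at this
  simp [← this, sumOver]

theorem integrable_pulls (a : Fin K) (n : ℕ) : Integrable (pulls a) (π.law μ n) :=
  integrable_sumOver_fst π μ (fun ab => if ab.1 = a then 1 else 0) n

/-- Expected number of pulls of an arm. -/
noncomputable def Policy.expPulls (n : ℕ) (a : Fin K) : ℝ :=
  ∫ h, pulls a h ∂(π.law μ n)

theorem expPulls_nonneg (n : ℕ) (a : Fin K) : 0 ≤ π.expPulls μ n a :=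
  integral_nonneg fun h => pulls_nonneg a h

theorem integral_sumOver_arm (w : Fin K → ℝ) (n : ℕ) :
    ∫ h, sumOver (fun r => w r.1.1) h ∂(π.law μ n) = ∑ a, w a * π.expPulls μ n a := by
  simp only [sumOver_arm]
  rw [integral_finsetSum _ fun a _ => (integrable_pulls π μ a n).const_mul _]
  simp only [integral_const_mul]
  rfl

theorem sum_expPulls (n : ℕ) : ∑ a, π.expPulls μ n a = n := by
  have h := integral_sumOver_arm π μ (fun _ => 1) n
  simpa [sumOver] using h.symm

theorem integrable_fun_id_gaussianReal (m : ℝ) : Integrable (fun x : ℝ => x) (gaussianReal m 1) := by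
  have h := memLp_id_gaussianReal (μ := m) (v := 1) 1
  exact memLp_one_iff_integrable.1 h

/-- The regret is at least the weighted sum of the expected numbers of pulls, if the weight of
each arm is at most its gap and at most the abstention regret. -/
theorem sum_mul_expPulls_le_regretRG {c : ℝ} {w : Fin K → ℝ} (hc : ∀ a, w a ≤ c)
    (hw : ∀ a, w a ≤ (⨆ i, μ i) - μ a) (T : ℕ) :
    ∑ a, w a * π.expPulls μ T a ≤ π.regretRG μ c T := by
  set g : Round K → ℝ := fun r => if r.1.2 then c else (⨆ i, μ i) - r.2 with hg_def
  have hg : Measurable g := by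
    refine Measurable.ite ?_ measurable_const (by fun_prop)
    exact (measurable_snd.comp measurable_fst) (measurableSet_singleton true)
  have hi : ∀ ab, Integrable (fun x => g (ab, x)) (gaussianReal (μ ab.1) 1) := by
    rintro ⟨a, b⟩
    cases b
    · exact (integrable_const _).sub (integrable_fun_id_gaussianReal _)
    · exact integrable_const _
  -- The conditional mean cost is the gap of the arm without abstention and `c` with it.
  have hm : ∀ ab, w ab.1 ≤ condMean μ g ab := by
    rintro ⟨a, b⟩
    cases b
    · simp only [condMean, g, Bool.false_eq_true, if_false]
      rw [integral_sub (integrable_const _) (integrable_fun_id_gaussianReal _),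
        integral_id_gaussianReal]
      simpa using hw a
    · simpa [condMean, g] using hc a
  have h1 : π.regretRG μ c T = ∫ h, sumOver g h ∂(π.law μ T) := rfl
  rw [h1, integral_sumOver π μ hg hi, ← integral_sumOver_arm]
  exact integral_mono (integrable_sumOver_fst π μ (fun ab => w ab.1) T)
    (integrable_sumOver_fst π μ _ T) fun h => Finset.sum_le_sum fun t _ => hm _

end Expectation

/-! ### Likelihood ratios and divergence between two instances. -/

section ChangeOfMeasure

variable {K : ℕ}

/-- Log-likelihood ratio of the observation of one round, between the instances `ν` and `μ`. -/
noncomputable def logRatio (μ ν : Fin K → ℝ) (r : Round K) : ℝ :=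
  (ν r.1.1 - μ r.1.1) * (r.2 - μ r.1.1) - (ν r.1.1 - μ r.1.1) ^ 2 / 2

theorem measurable_logRatio (μ ν : Fin K → ℝ) : Measurable (logRatio μ ν) := by
  have h1 : Measurable fun r : Round K => ν r.1.1 :=
    (measurable_of_finite ν).comp (measurable_fst.comp measurable_fst)
  have h2 : Measurable fun r : Round K => μ r.1.1 :=
    (measurable_of_finite μ).comp (measurable_fst.comp measurable_fst)
  unfold logRatio
  fun_prop

theorem gaussianReal_eq_withDensity (m m' : ℝ) :
    gaussianReal m' 1 = (gaussianReal m 1).withDensity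
      fun x => ENNReal.ofReal (Real.exp ((m' - m) * (x - m) - (m' - m) ^ 2 / 2)) := by
  rw [gaussianReal_of_var_ne_zero _ one_ne_zero, gaussianReal_of_var_ne_zero _ one_ne_zero,
    ← withDensity_mul _ (measurable_gaussianPDF _ _) (by fun_prop)]
  congr 1
  ext x
  rw [Pi.mul_apply, gaussianPDF, gaussianPDF, ← ENNReal.ofReal_mul (gaussianPDFReal_nonneg _ _ _)]
  congr 1
  simp only [gaussianPDFReal]
  rw [mul_assoc (_⁻¹), ← Real.exp_add]
  congr 2
  push_cast
  ring

theorem lintegral_step (π : Policy K) (μ : Fin K → ℝ) (n : ℕ) (h : History K n)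
    {f : Round K → ℝ≥0∞} (hf : Measurable f) :
    ∫⁻ r, f r ∂(π.step μ n h) =
      ∫⁻ ab, ∫⁻ x, f (ab, x) ∂(gaussianReal (μ ab.1) 1) ∂(π.act n h) := by
  rw [Policy.step, Kernel.lintegral_compProd _ _ _ hf]
  rfl

/-- The policy's kernel is common to both instances, so it cancels and only the Gaussian density
ratio remains. -/
theorem lintegral_step_change (π : Policy K) (μ ν : Fin K → ℝ) (n : ℕ) (h : History K n)
    {f : Round K → ℝ≥0∞} (hf : Measurable f) :
    ∫⁻ r, f r ∂(π.step ν n h) =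
      ∫⁻ r, ENNReal.ofReal (Real.exp (logRatio μ ν r)) * f r ∂(π.step μ n h) := by
  have hm := measurable_logRatio μ ν
  rw [lintegral_step π ν n h hf, lintegral_step π μ n h (by fun_prop)]
  refine lintegral_congr fun ab => ?_
  rw [gaussianReal_eq_withDensity (μ ab.1) (ν ab.1),
    lintegral_withDensity_eq_lintegral_mul _ (by fun_prop) (by fun_prop)]
  rfl

theorem lintegral_law_succ (π : Policy K) (μ : Fin K → ℝ) (n : ℕ)
    {f : History K (n + 1) → ℝ≥0∞} (hf : Measurable f) :
    ∫⁻ h, f h ∂(π.law μ (n + 1)) =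
      ∫⁻ h, ∫⁻ r, f (Fin.snoc h r : History K (n + 1)) ∂(π.step μ n h) ∂(π.law μ n) := by
  rw [Policy.law, lintegral_map hf (measurable_snoc K n)]
  exact Measure.lintegral_compProd (hf.comp (measurable_snoc K n))

/-- Change of measure between two instances. -/
theorem lintegral_law_change (π : Policy K) (μ ν : Fin K → ℝ) (n : ℕ)
    {f : History K n → ℝ≥0∞} (hf : Measurable f) :
    ∫⁻ h, f h ∂(π.law ν n) =
      ∫⁻ h, ENNReal.ofReal (Real.exp (sumOver (logRatio μ ν) h)) * f h ∂(π.law μ n) := by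
  have hm := measurable_logRatio μ ν
  induction n with
  | zero => simp [Policy.law, sumOver]
  | succ n ih =>
    have hs := measurable_sumOver (n := n + 1) hm
    have hfs := hf.comp (measurable_snoc K n)
    rw [lintegral_law_succ π ν n hf, lintegral_law_succ π μ n (by fun_prop), ih]
    · refine lintegral_congr fun h => ?_
      have hfh : Measurable fun r : Round K => f (Fin.snoc h r : History K (n + 1)) :=
        hfs.comp measurable_prodMk_left
      rw [lintegral_step_change π μ ν n h hfh, ← lintegral_const_mul _ (by fun_prop)]
      refine lintegral_congr fun r => ?_
      rw [sumOver_snoc, Real.exp_add, ENNReal.ofReal_mul (Real.exp_nonneg _), mul_assoc]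
    · exact hfs.lintegral_kernel_prod_right'

theorem law_change (π : Policy K) (μ ν : Fin K → ℝ) (n : ℕ) {s : Set (History K n)}
    (hs : MeasurableSet s) :
    π.law ν n s = ∫⁻ h in s, ENNReal.ofReal (Real.exp (sumOver (logRatio μ ν) h)) ∂(π.law μ n) := by
  rw [← lintegral_indicator_one hs, lintegral_law_change π μ ν n (measurable_one.indicator hs),
    ← lintegral_indicator hs]
  refine lintegral_congr fun h => ?_
  by_cases hh : h ∈ s <;> simp [hh]

theorem integrable_logRatio (μ ν : Fin K → ℝ) (ab : Fin K × Bool) :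
    Integrable (fun x => logRatio μ ν (ab, x)) (gaussianReal (μ ab.1) 1) :=
  (((integrable_fun_id_gaussianReal (μ ab.1)).sub (integrable_const (μ ab.1))).const_mul
    (ν ab.1 - μ ab.1)).sub (integrable_const ((ν ab.1 - μ ab.1) ^ 2 / 2))

/-- This is minus the KL divergence of two unit-variance Gaussians. -/
theorem condMean_logRatio (μ ν : Fin K → ℝ) (ab : Fin K × Bool) :
    condMean μ (logRatio μ ν) ab = -((ν ab.1 - μ ab.1) ^ 2 / 2) := by
  have h : Integrable (fun x => x - μ ab.1) (gaussianReal (μ ab.1) 1) :=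
    (integrable_fun_id_gaussianReal _).sub (integrable_const _)
  simp only [condMean, logRatio]
  rw [integral_sub (h.const_mul _) (integrable_const _), integral_const_mul,
    integral_sub (integrable_fun_id_gaussianReal _) (integrable_const _), integral_id_gaussianReal]
  simp

/-- Divergence decomposition. -/
theorem integral_sumOver_logRatio (π : Policy K) (μ ν : Fin K → ℝ) (n : ℕ) :
    ∫ h, sumOver (logRatio μ ν) h ∂(π.law μ n) =
      -∑ a, (ν a - μ a) ^ 2 / 2 * π.expPulls μ n a := by
  rw [integral_sumOver π μ (measurable_logRatio μ ν) (integrable_logRatio μ ν)]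
  simp only [condMean_logRatio]
  rw [integral_sumOver_arm π μ (fun a => -((ν a - μ a) ^ 2 / 2))]
  simp

end ChangeOfMeasure

/-! ### The Bretagnolle–Huber inequality. -/

/-- The Bretagnolle–Huber inequality, for `Q` with density `exp L` with respect to `P`. -/
theorem bretagnolle_huber {Ω : Type*} [MeasurableSpace Ω] {P Q : Measure Ω}
    [IsProbabilityMeasure P] [IsProbabilityMeasure Q] {L : Ω → ℝ} (hLm : Measurable L)
    (hL : Integrable L P)
    (hQ : ∀ s, MeasurableSet s → Q s = ∫⁻ ω in s, ENNReal.ofReal (Real.exp (L ω)) ∂P)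
    {s : Set Ω} (hs : MeasurableSet s) :
    Real.exp (∫ ω, L ω ∂P) / 2 ≤ P.real s + Q.real sᶜ := by
  have hreal : ∀ t, MeasurableSet t → Q.real t = ∫ ω in t, Real.exp (L ω) ∂P := by
    intro t ht
    rw [integral_eq_lintegral_of_nonneg_ae (ae_of_all _ fun _ => Real.exp_nonneg _)
      (by fun_prop), ← hQ t ht]
    rfl
  have hint : Integrable (fun ω => Real.exp (L ω)) P := by
    refine ⟨by fun_prop, ?_⟩
    rw [hasFiniteIntegral_iff_ofReal (ae_of_all _ fun _ => Real.exp_nonneg _),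
      ← setLIntegral_univ, ← hQ _ MeasurableSet.univ]
    simp
  have hone : ∫ ω, Real.exp (L ω) ∂P = 1 := by
    rw [← setIntegral_univ, ← hreal _ MeasurableSet.univ]
    simp
  set m := (∫ ω, L ω ∂P) / 2 with hm
  -- This `l` maximizes `2 * l * exp m - 2 * l ^ 2`, the integral of the left side of `hpt`; the
  -- maximum is `exp (2 * m) / 2`.
  set l := Real.exp m / 2 with hl
  have hl0 : 0 < l := by positivity
  -- With `u` the square root of the density, the tangent line of `exp` at `m` stays below `u`,
  -- which replaces Jensen. What remains is `(1 - l * u) ^ 2 ≥ 0` on `s` and `(u - l) ^ 2 ≥ 0` off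
  -- `s`.
  have hpt : ∀ ω, 2 * l * (Real.exp m * (1 + (L ω / 2 - m))) - l ^ 2 * (1 + Real.exp (L ω)) ≤
      s.indicator (fun _ => (1 : ℝ)) ω + sᶜ.indicator (fun ω => Real.exp (L ω)) ω := by
    intro ω
    set u := Real.exp (L ω / 2) with hu
    have huu : Real.exp (L ω) = u ^ 2 := by
      rw [hu, ← Real.exp_nat_mul]; congr 1; push_cast; ring
    have h1 : Real.exp m * (1 + (L ω / 2 - m)) ≤ u := by
      have h2 : u = Real.exp m * Real.exp (L ω / 2 - m) := by
        rw [hu, ← Real.exp_add]; congr 1; ring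
      rw [h2]
      gcongr
      linarith [Real.add_one_le_exp (L ω / 2 - m)]
    have h3 : 2 * l * (Real.exp m * (1 + (L ω / 2 - m))) ≤ 2 * l * u := by gcongr
    rw [huu]
    by_cases hω : ω ∈ s
    · simp only [hω, Set.indicator_of_mem, Set.mem_compl_iff, not_true_eq_false,
        not_false_eq_true, Set.indicator_of_notMem]
      nlinarith [sq_nonneg (1 - l * u), sq_nonneg l]
    · simp only [hω, Set.indicator_of_mem, Set.mem_compl_iff, not_false_eq_true,
        Set.indicator_of_notMem]
      nlinarith [sq_nonneg (u - l), sq_nonneg (l * u)]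
  have hI1 : Integrable (fun ω => 2 * l * (Real.exp m * (1 + (L ω / 2 - m)))) P := by fun_prop
  have hI2 : Integrable (fun ω => l ^ 2 * (1 + Real.exp (L ω))) P := by fun_prop
  have hI3 : Integrable (s.indicator fun _ => (1 : ℝ)) P := (integrable_const _).indicator hs
  have hI4 : Integrable (sᶜ.indicator fun ω => Real.exp (L ω)) P := hint.indicator hs.compl
  have hmono := integral_mono (hI1.sub hI2) (hI3.add hI4) hpt
  simp only [Pi.sub_apply, Pi.add_apply] at hmono
  rw [integral_sub hI1 hI2, integral_add hI3 hI4, integral_const_mul, integral_const_mul,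
    integral_const_mul, integral_add (integrable_const _) (by fun_prop),
    integral_sub (by fun_prop) (integrable_const _), integral_div, ← hm,
    integral_add (integrable_const _) hint, hone, integral_indicator hs,
    integral_indicator hs.compl, ← hreal _ hs.compl] at hmono
  simp only [integral_const, probReal_univ, smul_eq_mul, one_mul, mul_one, sub_self, add_zero,
    MeasurableSet.univ, measureReal_restrict_apply, Set.univ_inter] at hmono
  have hexp : Real.exp (∫ ω, L ω ∂P) = Real.exp m ^ 2 := by
    rw [← Real.exp_nat_mul]; congr 1; rw [hm]; push_cast; ring
  rw [hexp]
  have : Real.exp m = 2 * l := by rw [hl]; ring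
  rw [this] at hmono ⊢
  nlinarith

theorem IsUniqueOptimal.iSup_eq {K : ℕ} {μ : Fin K → ℝ} {i : Fin K} (h : IsUniqueOptimal μ i) :
    ⨆ j, μ j = μ i := by
  have : Nonempty (Fin K) := ⟨i⟩
  refine le_antisymm (ciSup_le fun j => ?_) (le_ciSup (Set.finite_range μ).bddAbove i)
  rcases eq_or_ne j i with rfl | hj
  · exact le_rfl
  · exact (h j hj).le

/-! ### Two-point regret bounds. -/

/-- If the arm `j` is the only good one in the instance `μ` and is bad in the instance `ν`, then
no policy has small regret on both, unless it distinguishes them. -/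
theorem two_point_bound {K : ℕ} (π : Policy K) {μ ν : Fin K → ℝ} {j : Fin K} {c d : ℝ}
    (hc : 0 < c) (hd : 0 < d) (hμ : ∀ a, a ≠ j → d ≤ (⨆ i, μ i) - μ a)
    (hν : d ≤ (⨆ i, ν i) - ν j) (T : ℕ) :
    min d c * (T / 4) * Real.exp (-∑ a, (ν a - μ a) ^ 2 / 2 * π.expPulls μ T a) ≤
      π.regretRG μ c T + π.regretRG ν c T := by
  have hsup : ∀ (ξ : Fin K → ℝ) (a : Fin K), 0 ≤ (⨆ i, ξ i) - ξ a := fun ξ a =>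
    sub_nonneg.2 (le_ciSup (Set.finite_range ξ).bddAbove a)
  set w := min d c with hw
  have hw0 : 0 < w := lt_min hd hc
  have hμR : w * (T - π.expPulls μ T j) ≤ π.regretRG μ c T := by
    refine le_trans (le_of_eq ?_) (sum_mul_expPulls_le_regretRG π μ (c := c)
      (w := fun a => if a = j then 0 else w) ?_ ?_ T)
    · rw [← sum_expPulls π μ T, ← Finset.add_sum_erase _ _ (Finset.mem_univ j),
        add_sub_cancel_left, ← Finset.add_sum_erase _ _ (Finset.mem_univ j), if_pos rfl, zero_mul,
        zero_add, Finset.mul_sum]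
      exact Finset.sum_congr rfl fun a ha => by rw [if_neg (Finset.ne_of_mem_erase ha)]
    · intro a
      split_ifs
      exacts [hc.le, min_le_right _ _]
    · intro a
      split_ifs with ha
      exacts [hsup _ _, (min_le_left _ _).trans (hμ a ha)]
  have hνR : w * π.expPulls ν T j ≤ π.regretRG ν c T := by
    refine le_trans (le_of_eq ?_) (sum_mul_expPulls_le_regretRG π ν (c := c)
      (w := fun a => if a = j then w else 0) ?_ ?_ T)
    · simp
    · intro a
      split_ifs
      exacts [min_le_right _ _, hc.le]
    · intro a
      split_ifs with ha
      · subst ha; exact (min_le_left _ _).trans hν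
      · exact hsup _ _
  have hle : ∀ h : History K T, pulls j h ≤ T := fun h => by
    rw [← sum_pulls h]
    exact Finset.single_le_sum (fun a _ => pulls_nonneg a h) (Finset.mem_univ j)
  -- At least half of the pulls miss `j`: costly under `μ`, while the complement is costly under
  -- `ν`. Markov's inequality quantifies both.
  let s : Set (History K T) := {h | (T : ℝ) / 2 ≤ T - pulls j h}
  have hs : MeasurableSet s :=
    measurableSet_le measurable_const (measurable_const.sub (measurable_pulls j))
  have h1 : (T : ℝ) / 2 * (π.law μ T).real s ≤ T - π.expPulls μ T j := by
    have h := mul_meas_ge_le_integral_of_nonneg (μ := π.law μ T)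
      (f := fun h => (T : ℝ) - pulls j h) (ae_of_all _ fun h => sub_nonneg.2 (hle h))
      ((integrable_const _).sub (integrable_pulls π μ j T)) ((T : ℝ) / 2)
    rw [integral_sub (integrable_const _) (integrable_pulls π μ j T)] at h
    simpa [Policy.expPulls] using h
  have h2 : (T : ℝ) / 2 * (π.law ν T).real sᶜ ≤ π.expPulls ν T j := by
    refine le_trans ?_ (mul_meas_ge_le_integral_of_nonneg (μ := π.law ν T)
      (f := pulls j) (ae_of_all _ fun h => pulls_nonneg j h) (integrable_pulls π ν j T)
      ((T : ℝ) / 2))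
    gcongr
    · finiteness
    · intro h hh
      simp only [s, Set.mem_compl_iff, Set.mem_ofPred_eq, not_le] at hh ⊢
      linarith
  have hBH := bretagnolle_huber (P := π.law μ T) (Q := π.law ν T)
    (measurable_sumOver (measurable_logRatio μ ν))
    (integrable_sumOver π μ (measurable_logRatio μ ν) (integrable_logRatio μ ν) T)
    (fun t ht => law_change π μ ν T ht) hs
  rw [integral_sumOver_logRatio] at hBH
  have h3 : w * (T / 2) * (Real.exp (-∑ a, (ν a - μ a) ^ 2 / 2 * π.expPulls μ T a) / 2) ≤
      w * (T / 2) * ((π.law μ T).real s + (π.law ν T).real sᶜ) := by gcongr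
  have h4 := mul_le_mul_of_nonneg_left (add_le_add h1 h2) hw0.le
  linarith

/-- Regret bound for two instances that only differ in one arm. -/
theorem two_point_bound_update {K : ℕ} (π : Policy K) {μ : Fin K → ℝ} {i j : Fin K} (hij : i ≠ j)
    (hopt : IsUniqueOptimal μ j) {c d : ℝ} (hc : 0 < c) (hd : 0 < d)
    (hgap : ∀ a, a ≠ j → d ≤ μ j - μ a) (T : ℕ) :
    IsUniqueOptimal (Function.update μ i (μ j + d)) i ∧
    min d c * (T / 4) * Real.exp (-((μ j - μ i + d) ^ 2 / 2 * π.expPulls μ T i)) ≤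
      π.regretRG μ c T + π.regretRG (Function.update μ i (μ j + d)) c T := by
  have hν : IsUniqueOptimal (Function.update μ i (μ j + d)) i := by
    intro a ha
    rw [Function.update_of_ne ha, Function.update_self]
    rcases eq_or_ne a j with rfl | haj
    · linarith
    · linarith [hgap a haj]
  refine ⟨hν, ?_⟩
  have h := two_point_bound π (μ := μ) (ν := Function.update μ i (μ j + d)) (j := j) hc hd
    (by rwa [hopt.iSup_eq]) (by
      rw [hν.iSup_eq, Function.update_self, Function.update_of_ne hij.symm]; linarith) T
  have hsum : ∑ a, (Function.update μ i (μ j + d) a - μ a) ^ 2 / 2 * π.expPulls μ T a =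
      (μ j - μ i + d) ^ 2 / 2 * π.expPulls μ T i := by
    rw [Finset.sum_eq_single i]
    · rw [Function.update_self]; ring
    · intro a _ ha
      rw [Function.update_of_ne ha]; simp
    · simp
  rwa [hsum] at h

/-! ### The instance-dependent bound. -/

theorem exists_gap {K : ℕ} {μ : Fin K → ℝ} {j : Fin K} (hopt : IsUniqueOptimal μ j) :
    ∃ d₀ > 0, ∀ a, a ≠ j → d₀ ≤ μ j - μ a := by
  by_cases hne : (Finset.univ.erase j).Nonempty
  · obtain ⟨b, hb, hmin⟩ := Finset.exists_min_image _ (fun a => μ j - μ a) hne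
    exact ⟨μ j - μ b, sub_pos.2 (hopt b (Finset.ne_of_mem_erase hb)),
      fun a ha => hmin a (Finset.mem_erase.2 ⟨ha, Finset.mem_univ a⟩)⟩
  -- With a single arm the condition is vacuous and any positive value serves.
  · exact ⟨1, one_pos, fun a ha => (hne ⟨a, Finset.mem_erase.2 ⟨ha, Finset.mem_univ a⟩⟩).elim⟩

theorem tendsto_log_natCast : Tendsto (fun T : ℕ => Real.log T) atTop atTop :=
  Real.tendsto_log_atTop.comp tendsto_natCast_atTop_atTop

/-- The same `d` is the margin of the raised arm and the exponent in consistency. Taking logarithms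
in the two-point bound loses `d * log T` from the regrets and the constant `log (8 / min d c)`,
which is eventually at most another `d * log T`. -/
theorem eventually_le_expPulls_of_gap {K : ℕ} {π : Algorithm K} (hπ : π.IsRGConsistent) {c : ℝ}
    (hc : 0 < c) {μ : Fin K → ℝ} {i j : Fin K} (hij : i ≠ j) (hopt : IsUniqueOptimal μ j) {d : ℝ}
    (hd : 0 < d) (hgap : ∀ a, a ≠ j → d ≤ μ j - μ a) :
    ∀ᶠ T : ℕ in atTop, (1 - 2 * d) * Real.log T ≤
      (μ j - μ i + d) ^ 2 / 2 * (π c T).expPulls μ T i := by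
  -- Optimality of the raised arm involves neither policy nor horizon, so horizon `0` is an
  -- arbitrary choice.
  have hν := (two_point_bound_update (π c 0) hij hopt hc hd hgap 0).1
  have h1 := (hπ c hc μ ⟨j, hopt⟩ d hd).bound one_pos
  have h2 := (hπ c hc _ ⟨i, hν⟩ d hd).bound one_pos
  have hw0 : 0 < min d c := lt_min hd hc
  have h3 := tendsto_log_natCast.eventually_ge_atTop (Real.log (8 / min d c) / d)
  filter_upwards [h1, h2, h3, eventually_ge_atTop 1] with T h1 h2 h3 hT
  have hT0 : (0 : ℝ) < T := by exact_mod_cast hT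
  have hb := (two_point_bound_update (π c T) hij hopt hc hd hgap T).2
  set x := (μ j - μ i + d) ^ 2 / 2 * (π c T).expPulls μ T i
  have hp : 0 < (T : ℝ) ^ d := by positivity
  rw [one_mul, Real.norm_of_nonneg hp.le] at h1 h2
  have h4 : (π c T).regretRG μ c T ≤ (T : ℝ) ^ d := (le_abs_self _).trans h1
  have h5 : (π c T).regretRG (Function.update μ i (μ j + d)) c T ≤ (T : ℝ) ^ d :=
    (le_abs_self _).trans h2
  have h6 : T * Real.exp (-x) ≤ 8 / min d c * (T : ℝ) ^ d := by
    rw [div_mul_eq_mul_div, le_div_iff₀ hw0]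
    linarith
  have h7 := Real.log_le_log (by positivity) h6
  rw [Real.log_mul hT0.ne' (Real.exp_ne_zero _), Real.log_exp,
    Real.log_mul (by positivity) hp.ne', Real.log_rpow hT0] at h7
  rw [div_le_iff₀ hd] at h3
  linarith

/-- A consistent algorithm pulls the arm `i` at least about `2 / Δᵢ² * log T` times. -/
theorem eventually_le_expPulls {K : ℕ} {π : Algorithm K} (hπ : π.IsRGConsistent) {c : ℝ}
    (hc : 0 < c) {μ : Fin K → ℝ} {i j : Fin K} (hij : i ≠ j) (hopt : IsUniqueOptimal μ j) {ρ : ℝ}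
    (hρ : ρ < 2 / (μ j - μ i) ^ 2) :
    ∀ᶠ T : ℕ in atTop, ρ * Real.log T ≤ (π c T).expPulls μ T i := by
  have hΔ : 0 < μ j - μ i := sub_pos.2 (hopt i hij)
  obtain ⟨d₀, hd₀, hgap⟩ := exists_gap hopt
  have hcont : Tendsto (fun d : ℝ => 2 * (1 - 2 * d) / (μ j - μ i + d) ^ 2) (nhdsWithin 0 (Set.Ioi 0))
      (nhds (2 * (1 - 2 * 0) / (μ j - μ i + 0) ^ 2)) := by
    refine tendsto_nhdsWithin_of_tendsto_nhds ?_
    refine ContinuousAt.div (by fun_prop) (by fun_prop) ?_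
    rw [add_zero]
    positivity
  have h1 := hcont.eventually_const_lt (u := ρ) (by simpa using hρ)
  obtain ⟨d, ⟨h1, hd⟩, hdd⟩ :=
    ((h1.and self_mem_nhdsWithin).and
      (mem_nhdsWithin_of_mem_nhds (Iic_mem_nhds hd₀))).exists
  filter_upwards [eventually_le_expPulls_of_gap hπ hc hij hopt hd
    fun a ha => le_trans hdd (hgap a ha), eventually_ge_atTop 1] with T hT hT1
  have hlog : 0 ≤ Real.log T := Real.log_natCast_nonneg T
  refine (mul_le_mul_of_nonneg_right h1.le hlog).trans ?_
  rw [div_mul_eq_mul_div, div_le_iff₀ (by positivity)]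
  linarith

/-- The instance-dependent lower bound. -/
theorem asymptotic_lower_bound {K : ℕ} {π : Algorithm K} (hπ : π.IsRGConsistent) {c : ℝ}
    (hc : 0 < c) {μ : Fin K → ℝ} {j : Fin K} (hopt : IsUniqueOptimal μ j) :
    ((2 * ∑ i ∈ Finset.univ.erase j, min (μ j - μ i) c / (μ j - μ i) ^ 2 : ℝ) : EReal) ≤
      liminf (fun T : ℕ => ((π.regretRG μ c T / Real.log T : ℝ) : EReal)) atTop := by
  set S := 2 * ∑ i ∈ Finset.univ.erase j, min (μ j - μ i) c / (μ j - μ i) ^ 2 with hS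
  refine EReal.ge_of_forall_gt_iff_ge.1 fun y hy => ?_
  have hy : y < S := EReal.coe_lt_coe_iff.1 hy
  have hcont : Tendsto (fun θ : ℝ => θ * S) (nhdsWithin 1 (Set.Iio 1)) (nhds (1 * S)) :=
    tendsto_nhdsWithin_of_tendsto_nhds (by fun_prop : Continuous fun θ : ℝ => θ * S).continuousAt
  -- The factor `θ < 1` provides the strict slack below `2 / Δᵢ²` required by
  -- `eventually_le_expPulls`.
  obtain ⟨θ, hθ, hθ1⟩ :=
    ((hcont.eventually_const_lt (u := y) (by simpa using hy)).and self_mem_nhdsWithin).exists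
  have hΔ : ∀ i ∈ Finset.univ.erase j, 0 < μ j - μ i := fun i hi =>
    sub_pos.2 (hopt i (Finset.ne_of_mem_erase hi))
  have hev : ∀ᶠ T : ℕ in atTop, ∀ i ∈ Finset.univ.erase j,
      θ * (2 / (μ j - μ i) ^ 2) * Real.log T ≤ (π c T).expPulls μ T i := by
    rw [eventually_all_finset]
    intro i hi
    have := hΔ i hi
    refine eventually_le_expPulls hπ hc (Finset.ne_of_mem_erase hi) hopt ?_
    exact mul_lt_of_lt_one_left (by positivity) hθ1
  refine le_liminf_of_le (by isBoundedDefault) ?_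
  filter_upwards [hev, tendsto_log_natCast.eventually_gt_atTop 0] with T hT hlog
  refine EReal.coe_le_coe_iff.2 (hθ.le.trans ?_)
  rw [le_div_iff₀ hlog]
  have hw : ∀ a, min (μ j - μ a) c ≤ (⨆ i, μ i) - μ a := fun a => by
    rw [hopt.iSup_eq]; exact min_le_left _ _
  refine le_trans ?_ (sum_mul_expPulls_le_regretRG (π c T) μ (c := c) (fun a => min_le_right _ _)
    hw T)
  rw [← Finset.add_sum_erase _ _ (Finset.mem_univ j), sub_self, min_eq_left hc.le, zero_mul,
    zero_add, hS, Finset.mul_sum, Finset.mul_sum, Finset.sum_mul]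
  refine Finset.sum_le_sum fun i hi => ?_
  have hm : 0 ≤ min (μ j - μ i) c := le_min (hΔ i hi).le hc.le
  calc _ = min (μ j - μ i) c * (θ * (2 / (μ j - μ i) ^ 2) * Real.log T) := by ring
    _ ≤ _ := mul_le_mul_of_nonneg_left (hT i hi) hm

/-! ### The minimax bound. -/

/-- The minimax lower bound, for a given policy. -/
theorem exists_instance_regretRG_ge {K : ℕ} (hK : 2 ≤ K) {c : ℝ} (hc : 0 < c) {T : ℕ}
    (hT : 0 < T) (π : Policy K) :
    ∃ μ ∈ instances K, 1 / 64 * min (Real.sqrt (K * T)) (c * T) ≤ π.regretRG μ c T := by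
  have hT0 : (0 : ℝ) < T := by exact_mod_cast hT
  have hK2 : (2 : ℝ) ≤ K := by exact_mod_cast hK
  have hK1 : (0 : ℝ) < K - 1 := by linarith
  -- The shift is `2 * d` and arm `i` has at most `T / (K - 1)` expected pulls, so this choice makes
  -- the divergence at most `1 / 2`.
  set d := Real.sqrt ((K - 1) / T) / 2 with hd_def
  have hd : 0 < d := by positivity
  have hd2 : d ^ 2 = (K - 1) / T / 4 := by
    rw [hd_def, div_pow, Real.sq_sqrt (by positivity)]; norm_num
  have : NeZero K := ⟨by omega⟩
  set μ : Fin K → ℝ := fun a => if a = 0 then d else 0 with hμ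
  have hμ0 : μ 0 = d := if_pos rfl
  have hμa : ∀ a, a ≠ 0 → μ a = 0 := fun a ha => if_neg ha
  have hopt : IsUniqueOptimal μ 0 := fun a ha => by rwa [hμ0, hμa a ha]
  obtain ⟨i, hi, hpulls⟩ : ∃ i ∈ Finset.univ.erase (0 : Fin K),
      π.expPulls μ T i ≤ T / (K - 1) := by
    refine Finset.exists_le_of_sum_le ?_ ?_
    · rw [← Finset.card_pos, Finset.card_erase_of_mem (Finset.mem_univ _), Finset.card_fin]
      omega
    · rw [Finset.sum_const, Finset.card_erase_of_mem (Finset.mem_univ _), Finset.card_fin,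
        nsmul_eq_mul, Nat.cast_sub (by omega), Nat.cast_one, mul_div_cancel₀ _ hK1.ne',
        ← sum_expPulls π μ T]
      exact Finset.sum_le_sum_of_subset_of_nonneg (Finset.erase_subset _ _)
        fun a _ _ => expPulls_nonneg π μ T a
  have hi0 := Finset.ne_of_mem_erase hi
  obtain ⟨hν, hb⟩ := two_point_bound_update π hi0 hopt hc hd
    (fun a ha => by rw [hμ0, hμa a ha, sub_zero]) T
  rw [hμ0, hμa i hi0] at hb
  rw [hμ0] at hν
  have hexp : (1 : ℝ) / 2 ≤ Real.exp (-((d - 0 + d) ^ 2 / 2 * π.expPulls μ T i)) := by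
    have h1 : (d - 0 + d) ^ 2 / 2 * π.expPulls μ T i ≤ 1 / 2 := by
      calc _ ≤ (d - 0 + d) ^ 2 / 2 * (T / (K - 1)) := by gcongr
        _ = 2 * d ^ 2 * (T / (K - 1)) := by ring
        _ = 1 / 2 := by rw [hd2]; field_simp; norm_num
    linarith [Real.add_one_le_exp (-((d - 0 + d) ^ 2 / 2 * π.expPulls μ T i))]
  -- Here `(4 * d * T) ^ 2 = 4 * (K - 1) * T ≥ K * T`, because `K ≥ 2`.
  have hmin : min (Real.sqrt (K * T)) (c * T) / 4 ≤ min d c * T := by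
    rw [min_mul_of_nonneg _ _ hT0.le]
    have hdT : Real.sqrt (K * T) / 4 ≤ d * T := by
      rw [div_le_iff₀ (by norm_num)]
      refine Real.sqrt_le_iff.2 ⟨by positivity, ?_⟩
      have : (d * T * 4) ^ 2 = 4 * (K - 1) * T := by
        rw [mul_pow, mul_pow, hd2]; field_simp
      rw [this]
      gcongr
      linarith
    refine le_min ((div_le_div_of_nonneg_right (min_le_left _ _) (by norm_num)).trans hdT) ?_
    have := min_le_right (Real.sqrt (K * T)) (c * T)
    have : 0 < c * T := by positivity
    linarith
  have hw0 : 0 < min d c := lt_min hd hc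
  -- The constant is `1/4` from `hmin`, `1/4` from the two-point bound and `1/2` from `hexp`; the
  -- larger of the two regrets gets half of it.
  have hsum : 1 / 32 * min (Real.sqrt (K * T)) (c * T) ≤
      π.regretRG μ c T + π.regretRG (Function.update μ i (d + d)) c T := by
    refine le_trans ?_ hb
    have := mul_le_mul_of_nonneg_left hexp (by positivity : 0 ≤ min d c * (T / 4))
    linarith
  by_cases h : 1 / 64 * min (Real.sqrt (K * T)) (c * T) ≤ π.regretRG μ c T
  · exact ⟨μ, ⟨0, hopt⟩, h⟩
  · exact ⟨_, ⟨i, hν⟩, by linarith⟩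

end AbstentionBandit

theorem theorem2 :
    (∀ (K : ℕ) (π : AbstentionBandit.Algorithm K),
      AbstentionBandit.Algorithm.IsRGConsistent π →
      ∀ (c : ℝ), 0 < c → ∀ (μ : Fin K → ℝ) (i₀ : Fin K),
        AbstentionBandit.IsUniqueOptimal μ i₀ →
        ((2 * ∑ i ∈ Finset.univ.erase i₀,
            min (μ i₀ - μ i) c / (μ i₀ - μ i) ^ 2 : ℝ) : EReal) ≤
          liminf (fun T : ℕ =>
            ((AbstentionBandit.Algorithm.regretRG π μ c T / Real.log T : ℝ) : EReal)) atTop) ∧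
    (∃ α : ℝ, 0 < α ∧ ∀ (K : ℕ), 2 ≤ K → ∀ (c : ℝ), 0 < c → ∀ (T : ℕ), K ≤ T →
      ((α * min (Real.sqrt (K * T)) (c * T) : ℝ) : EReal) ≤
        ⨅ π : AbstentionBandit.Policy K, ⨆ μ ∈ AbstentionBandit.instances K,
          ((AbstentionBandit.Policy.regretRG π μ c T : ℝ) : EReal)) := by
  refine ⟨fun K π hπ c hc μ i₀ hopt => AbstentionBandit.asymptotic_lower_bound hπ hc hopt,
    1 / 64, by norm_num, fun K hK c hc T hT => le_iInf fun π => ?_⟩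
  obtain ⟨μ, hμ, h⟩ := AbstentionBandit.exists_instance_regretRG_ge hK hc (by omega : 0 < T) π
  exact le_iSup₂_of_le μ hμ (EReal.coe_le_coe_iff.2 h)
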